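/- Let $A,B$ be independent $N\times N$ matrices with independent standard real Gaussian entries, and let $p^{\rm r}_{N,M}$ be the probability that $AB^{-1}$ has exactly $M$ real eigenvalues. For $0<\alpha\le 1$ let $E_\alpha$ be the infimum of the electrostatic energy $$\frac12\iint -\log\|x-y\|\,d\nu(x)\,d\nu(y)-\iint -\log\|x-y\|\,d\nu(x)\,d\sigma(y)+\frac12\iint -\log\|x-y\|\,d\sigma(x)\,d\sigma(y)$$ over all positive measures $\nu$ on the sphere $S\subset\mathbb R^3$ of radius $1/2$ that are symmetric about the equator and have total charge $\alpha$ on the equator and total charge $1-\alpha$ on the rest of $S$; here $\sigma$ is the uniform probability measure on $S$ (so that $-\sigma$ is the neutralising background). Fix $\alpha\in(0,1]$, and let $N\to\infty$ through the pairs $(N,M)$ with $M=\alpha N$ and $M\equiv N \pmod 2$. Assume the electrostatics hypothesis that $-N^{-2}\log p^{\rm r}_{N,M}\to E_\alpha$ in this limit. Then, in the same limit, $$\log p^{\rm r}_{N,M}\sim-\frac{N^2}{8}\Big(-2\alpha+(\alpha-1)\big((1-\alpha)\log(1-\alpha)-(\alpha+1)\log(1+\alpha)\big)+2\alpha(\alpha+1)\log(1+\alpha)\Big),$$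 that is, the ratio of the two sides tends to $1$. For $\alpha=1$ the bracket is understood as its limit for $\alpha\to1^-$, and the right-hand side is then $N^2\big(\frac14-\frac12\log 2\big)$. -/

import Mathlib

open Filter Topology MeasureTheory ProbabilityTheory Asymptotics

namespace RealSpherical

/-! ### The real spherical ensemble -/

/-- The law of an `N × N` array of independent standard real Gaussian variables. -/
noncomputable def ginOE (N : ℕ) : Measure (Fin N → Fin N → ℝ) :=
  Measure.pi fun _ => Measure.pi fun _ => gaussianReal 0 1

/-- The number of real eigenvalues of a real square matrix, counted with algebraic multiplicity. -/
noncomputable def realEigenvalueCount {N : ℕ} (X : Matrix (Fin N) (Fin N) ℝ) : ℕ :=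
  Multiset.card X.charpoly.roots

/-- The probability that `A * B⁻¹` has exactly `M` real eigenvalues, where `A` and `B` are
independent `N × N` standard real Gaussian matrices (`B` is almost surely invertible). -/
noncomputable def probReal (N M : ℕ) : ℝ :=
  ((ginOE N).prod (ginOE N)).real
    {P | realEigenvalueCount (Matrix.of P.1 * (Matrix.of P.2)⁻¹) = M}

/-- The limit `N → ∞` through the pairs `(N, M)` with `M / N = α` fixed. As non-real eigenvalues
come in conjugate pairs, `M` has to have the parity of `N`. -/
def fixedRatio (α : ℝ) : Filter (ℕ × ℕ) :=
  comap Prod.fst atTop ⊓ 𝓟 {p | (p.2 : ℝ) = α * p.1 ∧ p.2 ≡ p.1 [MOD 2]}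

/-! ### Electrostatics on the sphere of radius `1/2` -/

/-- Three-dimensional Euclidean space. -/
abbrev Space : Type := EuclideanSpace ℝ (Fin 3)

/-- The sphere of radius `1/2` about the origin. -/
def sphere : Set Space := Metric.sphere 0 (1 / 2)

/-- The equator of the sphere. -/
def equator : Set Space := {x | x ∈ sphere ∧ x 2 = 0}

/-- The reflection in the plane of the equator. -/
noncomputable def mirror (x : Space) : Space := !₂[x 0, x 1, -x 2]

/-- The point of the sphere with polar angle `p.1` and azimuthal angle `p.2`. -/
noncomputable def spherePoint (p : ℝ × ℝ) : Space :=
  !₂[Real.sin p.1 * Real.cos p.2 / 2, Real.sin p.1 * Real.sin p.2 / 2, Real.cos p.1 / 2]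

/-- The uniform probability distribution on the sphere: area density `1 / π`, with the area
element `(1/4) sin θ dθ dφ`. -/
noncomputable def uniformCharge : Measure Space :=
  (((volume : Measure (ℝ × ℝ)).restrict
      (Set.Icc 0 Real.pi ×ˢ Set.Icc 0 (2 * Real.pi))).withDensity
    fun p => ENNReal.ofReal (1 / Real.pi * (Real.sin p.1 / 4))).map spherePoint

open Classical in
/-- The Coulomb pair potential `-log ‖x - y‖` between unit charges on the sphere, infinite on the
diagonal. It is nonnegative there, the sphere having diameter `1`, so that `ENNReal.ofReal`
truncates nothing; values off the sphere are irrelevant. -/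
noncomputable def coulomb (x y : Space) : ENNReal :=
  if x = y then ⊤ else ENNReal.ofReal (-Real.log (dist x y))

/-- The mutual Coulomb integral `∫∫ -log ‖x - y‖ dμ(x) dν(y)` of two charge distributions. -/
noncomputable def mutualEnergy (μ ν : Measure Space) : ENNReal :=
  ∫⁻ x, ∫⁻ y, coulomb x y ∂ν ∂μ

/-- The electrostatic energy of the charge distribution `ν` together with the neutralising
uniform background of total charge `-1`: charge-charge, charge-background and
background-background interactions, the self-interactions halved because each pair counts once.
The last two terms are finite (for `ν` a probability measure on the sphere). -/
noncomputable def energy (ν : Measure Space) : EReal :=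
  ((1 / 2 : ℝ) : EReal) * (mutualEnergy ν ν : EReal) - (mutualEnergy ν uniformCharge : EReal)
    + ((1 / 2 : ℝ) : EReal) * (mutualEnergy uniformCharge uniformCharge : EReal)

/-- The positive charge distributions on the sphere with charge `α` on the equator and charge
`1 - α` on the rest of the sphere, symmetrical about the equator. -/
structure IsAdmissible (α : ℝ) (ν : Measure Space) : Prop where
  on_sphere : ν sphereᶜ = 0
  on_equator : ν equator = ENNReal.ofReal α
  on_body : ν (sphere \ equator) = ENNReal.ofReal (1 - α)
  symmetric : ν.map mirror = ν

/-- The minimum electrostatic energy under the constraints. -/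
noncomputable def minEnergy (α : ℝ) : EReal :=
  ⨅ (ν : Measure Space) (_ : IsAdmissible α ν), energy ν

/-- The electrostatics hypothesis at ratio `α`: `-N⁻² log p_{N,M}` tends to the minimum energy
as `N → ∞` with `M / N = α`. -/
def ElectrostaticsHypothesis (α : ℝ) : Prop :=
  Tendsto (fun p : ℕ × ℕ => ((-(1 / (p.1 : ℝ) ^ 2) * Real.log (probReal p.1 p.2) : ℝ) : EReal))
    (fixedRatio α) (𝓝 (minEnergy α))

/-- The function of `α` in the large deviation formula. -/
noncomputable def rate (α : ℝ) : ℝ :=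
  -2 * α + (α - 1) * ((1 - α) * Real.log (1 - α) - (α + 1) * Real.log (1 + α))
    + 2 * α * (α + 1) * Real.log (1 + α)

end RealSpherical

namespace RealSpherical

/-! The hypothesis reduces the theorem to the value of the minimum: it suffices that `minEnergy α =
rate α / 8` with `rate α > 0`.

Write I(μ, ν) for `mutualEnergy`. The background has constant potential 1/2 on the sphere, so the
energy of an admissible ν is I(ν, ν)/2 - 1/4 and only I(ν, ν) has to be minimised. The minimiser e,
`equilibrium α`, is the uniform charge with the belt |cos θ| < α emptied and its charge, exactly α,
swept to the equator. From a point of a cap, the potential of a rotation invariant charge lying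
wholly on its other side depends on the point through the total charge alone. Sweeping, which
respects the reflection, therefore changes the potential on the caps by a constant: it equals
`capValue α` there. In the emptied belt it exceeds `capValue α` by half a relative entropy
(`potential_equilibrium_gap`), and on the equator it is `ringValue α`. As an admissible ν has
charges α and 1 - α on the equator and off it, I(e, e) ≤ I(ν, e)
(`le_mutualEnergy_equilibrium_right`).

The logarithmic kernel is positive semidefinite on differences of probability measures, being a
mixture of Gaussians up to constants: 2 I(ν, e) ≤ I(ν, ν) + I(e, e) (`two_mul_mutualEnergy_le`).
Since I(e, e) is finite, I(e, e) ≤ I(ν, ν) follows. -/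

/-! ### The logarithmic kernel as a mixture of Gaussians -/

open Set Real in
theorem lintegral_exp_sub_exp_div {a : ℝ} (ha : 0 < a) (ha1 : a ≤ 1) :
    ∫⁻ t in Ioi (0 : ℝ), ENNReal.ofReal ((exp (-(t * a)) - exp (-t)) / t)
      = ENNReal.ofReal (-log a) := by
  -- Frullani's integral: the quotient is the integral of exp(-ts) over s from a to 1, and Tonelli
  -- leaves the integral of 1/s.
  have h1 : ∀ t ∈ Ioi (0 : ℝ), ENNReal.ofReal ((exp (-(t * a)) - exp (-t)) / t)
      = ∫⁻ s in Ioc a 1, ENNReal.ofReal (exp (-(t * s))) := by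
    intro t ht
    have ht' : t ≠ 0 := ne_of_gt ht
    rw [← ofReal_integral_eq_lintegral_ofReal]
    · congr 1
      rw [← intervalIntegral.integral_of_le ha1,
        intervalIntegral.integral_eq_sub_of_hasDerivAt (f := fun s => -exp (-(t * s)) / t)]
      · simp only [mul_one]; ring
      · intro s _
        have h : HasDerivAt (fun s : ℝ => -(t * s)) (-(t * 1)) s :=
          ((hasDerivAt_id s).const_mul t).neg
        refine (h.exp.neg.div_const t).congr_deriv ?_
        field_simp
      · exact Continuous.intervalIntegrable (by fun_prop) _ _
    · exact (Continuous.integrableOn_Icc (by fun_prop)).mono_set Ioc_subset_Icc_self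
    · exact Eventually.of_forall fun s => (exp_pos _).le
  rw [setLIntegral_congr_fun measurableSet_Ioi h1, lintegral_lintegral_swap]
  · have h2 : ∀ s ∈ Ioc a 1, ∫⁻ t in Ioi (0 : ℝ), ENNReal.ofReal (exp (-(t * s)))
        = ENNReal.ofReal s⁻¹ := by
      intro s hs
      have hs0 : -s < 0 := by linarith [hs.1]
      rw [← ofReal_integral_eq_lintegral_ofReal]
      · congr 1
        have := integral_exp_mul_Ioi hs0 0
        simp only [mul_zero, exp_zero] at this
        rw [← one_div, ← neg_div_neg_eq, ← this]
        congr 1; ext t; congr 1; ring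
      · have := integrableOn_exp_mul_Ioi hs0 0
        simpa only [neg_mul, mul_comm _ s, IntegrableOn] using this
      · exact Eventually.of_forall fun s => (exp_pos _).le
    rw [setLIntegral_congr_fun measurableSet_Ioc h2, ← ofReal_integral_eq_lintegral_ofReal]
    · rw [← intervalIntegral.integral_of_le ha1, integral_inv_of_pos ha one_pos, one_div, log_inv]
    · rw [← IntegrableOn, ← intervalIntegrable_iff_integrableOn_Ioc_of_le ha1]
      refine intervalIntegrable_inv_iff.2 (Or.inr ?_)
      rw [uIcc_of_le ha1]; intro h; exact absurd h.1 (not_le.2 ha)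
    · filter_upwards [ae_restrict_mem measurableSet_Ioc] with s hs
      exact (inv_pos.2 (ha.trans hs.1)).le
  · exact (Measurable.ennreal_ofReal (by fun_prop)).aemeasurable

open Set Real in
theorem lintegral_one_sub_exp_div :
    ∫⁻ t in Ioi (0 : ℝ), ENNReal.ofReal ((exp (-(t * 0)) - exp (-t)) / t) = ⊤ := by
  refine ENNReal.eq_top_of_forall_nnreal_le fun r => ?_
  -- With a = exp(-r) the Frullani integral is r, and the integrand at 0 dominates the one at a.
  have h := lintegral_exp_sub_exp_div (exp_pos (-(r : ℝ))) (by simp)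
  rw [log_exp, neg_neg, ENNReal.ofReal_coe_nnreal] at h
  rw [← h]
  refine setLIntegral_mono' measurableSet_Ioi fun t ht => ENNReal.ofReal_le_ofReal ?_
  have ht : 0 < t := ht
  gcongr
  exact (exp_pos _).le

/-- The Gaussian interaction of two points. -/
noncomputable def gaussKernel (t : ℝ) (x y : Space) : ENNReal :=
  ENNReal.ofReal (Real.exp (-(t * dist x y ^ 2)))

@[fun_prop]
theorem measurable_gaussKernel {X : Type*} [MeasurableSpace X] {τ : X → ℝ} {f g : X → Space}
    (hτ : Measurable τ) (hf : Measurable f) (hg : Measurable g) :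
    Measurable fun p => gaussKernel (τ p) (f p) (g p) := by
  unfold gaussKernel
  exact Measurable.ennreal_ofReal (by fun_prop)

theorem dist_le_one {x y : Space} (hx : x ∈ sphere) (hy : y ∈ sphere) : dist x y ≤ 1 := by
  have hx : dist x 0 = 1 / 2 := hx
  have hy : dist y 0 = 1 / 2 := hy
  have := dist_triangle_right x y 0
  linarith

-- Frullani's integral at a = ‖x - y‖²; the square accounts for the factor 1/2. Distance at most 1
-- keeps the truncated subtraction exact, and on the diagonal both sides are infinite.
open Set in
theorem coulomb_eq_lintegral_gaussKernel {x y : Space} (h : dist x y ≤ 1) :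
    coulomb x y = ∫⁻ t in Ioi (0 : ℝ),
      ENNReal.ofReal (1 / (2 * t)) * (gaussKernel t x y - ENNReal.ofReal (Real.exp (-t))) := by
  have h1 : ∀ t ∈ Ioi (0 : ℝ),
      ENNReal.ofReal (1 / (2 * t)) * (gaussKernel t x y - ENNReal.ofReal (Real.exp (-t)))
      = ENNReal.ofReal (1 / 2) *
        ENNReal.ofReal ((Real.exp (-(t * dist x y ^ 2)) - Real.exp (-t)) / t) := by
    intro t ht
    have ht : 0 < t := ht
    rw [gaussKernel, ← ENNReal.ofReal_sub _ (Real.exp_pos _).le,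
      ← ENNReal.ofReal_mul (by positivity), ← ENNReal.ofReal_mul (by positivity)]
    congr 1; field_simp
  rw [setLIntegral_congr_fun measurableSet_Ioi h1, lintegral_const_mul _ (by fun_prop)]
  by_cases hxy : x = y
  · subst hxy
    rw [coulomb, if_pos rfl, dist_self, zero_pow two_ne_zero, lintegral_one_sub_exp_div,
      ENNReal.mul_top (by simp)]
  · have hd : 0 < dist x y := dist_pos.2 hxy
    rw [coulomb, if_neg hxy, lintegral_exp_sub_exp_div (by positivity)
      (pow_le_one₀ hd.le h), ← ENNReal.ofReal_mul (by norm_num), Real.log_pow]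
    congr 1; push_cast; ring

/-! ### Positive semidefiniteness of the logarithmic energy -/

theorem lintegral_gaussKernel_ne_top {t : ℝ} (ht : 0 < t) :
    ∫⁻ z : Space, gaussKernel t z 0 ≠ ⊤ := by
  have h := (GaussianFourier.integrable_cexp_neg_mul_sq_norm_add (V := Space) (b := (t : ℂ))
    (by simpa using ht) 0 0).norm.lintegral_lt_top
  refine ne_of_lt (lt_of_le_of_lt (lintegral_mono fun z => ?_) h)
  rw [gaussKernel, Complex.norm_exp]
  refine ENNReal.ofReal_le_ofReal (le_of_eq ?_)
  simp [← Complex.ofReal_pow]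

theorem lintegral_gaussKernel_ne_zero (t : ℝ) : ∫⁻ z : Space, gaussKernel t z 0 ≠ 0 := by
  refine ne_of_gt ((lintegral_pos_iff_support ?_).2 ?_)
  · fun_prop
  · have : Function.support (fun z : Space => gaussKernel t z 0) = Set.univ := by
      ext z; simp [gaussKernel, Real.exp_pos]
    rw [this]; simp

/-- Parallelogram identity: 2t‖x - z‖² + 2t‖y - z‖² = 4t‖z - (x + y)/2‖² + t‖x - y‖². The Gaussian
kernel is thus a Gram kernel up to a constant. -/
theorem lintegral_gaussKernel_mul_gaussKernel (t : ℝ) (x y : Space) :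
    ∫⁻ z : Space, gaussKernel (2 * t) x z * gaussKernel (2 * t) y z
      = (∫⁻ z : Space, gaussKernel (4 * t) z 0) * gaussKernel t x y := by
  have h1 : ∀ z : Space, gaussKernel (2 * t) x z * gaussKernel (2 * t) y z
      = gaussKernel (4 * t) (z - (1 / 2 : ℝ) • (x + y)) 0 * gaussKernel t x y := by
    intro z
    simp only [gaussKernel]
    rw [← ENNReal.ofReal_mul (Real.exp_pos _).le, ← ENNReal.ofReal_mul (Real.exp_pos _).le,
      ← Real.exp_add, ← Real.exp_add]
    congr 2
    simp only [EuclideanSpace.dist_eq, Real.dist_eq, sq_abs, Fin.sum_univ_three]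
    rw [Real.sq_sqrt (by positivity), Real.sq_sqrt (by positivity), Real.sq_sqrt (by positivity),
      Real.sq_sqrt (by positivity)]
    simp; ring
  simp_rw [h1]
  rw [lintegral_mul_const _ (by fun_prop)]
  congr 1
  exact lintegral_sub_right_eq_self (fun z : Space => gaussKernel (4 * t) z 0) _

theorem lintegral_lintegral_gaussKernel (t : ℝ) (μ ν : Measure Space) [SFinite μ] [SFinite ν] :
    (∫⁻ z : Space, gaussKernel (4 * t) z 0) * ∫⁻ x, ∫⁻ y, gaussKernel t x y ∂ν ∂μ
      = ∫⁻ z : Space, (∫⁻ x, gaussKernel (2 * t) x z ∂μ) * ∫⁻ y, gaussKernel (2 * t) y z ∂ν := by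
  have hm : Measurable fun p : Space × Space => gaussKernel t p.1 p.2 := by fun_prop
  have hm2 : Measurable fun z : Space => ∫⁻ y, gaussKernel (2 * t) y z ∂ν :=
    Measurable.lintegral_prod_left' (f := fun p : Space × Space => gaussKernel (2 * t) p.1 p.2)
      (by fun_prop)
  rw [← lintegral_const_mul _ (by exact hm.lintegral_prod_right')]
  have h1 : ∀ x, (∫⁻ z : Space, gaussKernel (4 * t) z 0) * ∫⁻ y, gaussKernel t x y ∂ν
      = ∫⁻ z, gaussKernel (2 * t) x z * ∫⁻ y, gaussKernel (2 * t) y z ∂ν := by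
    intro x
    rw [← lintegral_const_mul _ (by fun_prop)]
    simp_rw [← lintegral_gaussKernel_mul_gaussKernel]
    rw [lintegral_lintegral_swap]
    · refine lintegral_congr fun z => ?_
      rw [lintegral_const_mul _ (by fun_prop)]
    · fun_prop
  simp_rw [h1]
  rw [lintegral_lintegral_swap]
  · refine lintegral_congr fun z => ?_
    rw [lintegral_mul_const _ (by fun_prop)]
  · exact Measurable.aemeasurable (Measurable.mul (by fun_prop) (hm2.comp measurable_snd))

theorem two_mul_mul_le_add (a b : ENNReal) : 2 * (a * b) ≤ a * a + b * b := by
  wlog h : a ≤ b generalizing a b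
  · rw [mul_comm a b, add_comm]; exact this b a (le_of_not_ge h)
  obtain ⟨c, rfl⟩ := exists_add_of_le h
  calc 2 * (a * (a + c)) ≤ 2 * (a * (a + c)) + c * c := le_self_add
    _ = _ := by ring

/-- By the Gram representation all three terms are integrals over z of products of smoothed
densities, where 2ab ≤ a² + b² applies pointwise. The common constant cancels because it is neither
0 nor infinite. -/
theorem two_mul_lintegral_gaussKernel_le {t : ℝ} (ht : 0 < t) (μ ν : Measure Space)
    [SFinite μ] [SFinite ν] :
    2 * ∫⁻ x, ∫⁻ y, gaussKernel t x y ∂ν ∂μ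
      ≤ ∫⁻ x, ∫⁻ y, gaussKernel t x y ∂μ ∂μ + ∫⁻ x, ∫⁻ y, gaussKernel t x y ∂ν ∂ν := by
  have hmμ : ∀ κ : Measure Space, SFinite κ →
      Measurable fun z : Space => ∫⁻ y, gaussKernel (2 * t) y z ∂κ :=
    fun κ _ => Measurable.lintegral_prod_left'
      (f := fun p : Space × Space => gaussKernel (2 * t) p.1 p.2) (by fun_prop)
  rw [← ENNReal.mul_le_mul_iff_right (lintegral_gaussKernel_ne_zero (4 * t))
    (lintegral_gaussKernel_ne_top (by positivity : 0 < 4 * t)), mul_add, mul_left_comm]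
  simp_rw [lintegral_lintegral_gaussKernel]
  rw [← lintegral_const_mul' _ _ (by simp),
    ← lintegral_add_left (by exact (hmμ μ inferInstance).mul (hmμ μ inferInstance))]
  exact lintegral_mono fun z => two_mul_mul_le_add _ _

-- For probability measures the subtracted constant integrates to exp(-t) whichever pair is taken,
-- so it cancels when energies are compared at fixed t.
open Set in
theorem mutualEnergy_eq_lintegral_gaussKernel (μ ν : Measure Space) [IsProbabilityMeasure μ]
    [IsProbabilityMeasure ν] (hμ : ∀ᵐ x ∂μ, x ∈ sphere) (hν : ∀ᵐ x ∂ν, x ∈ sphere) :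
    mutualEnergy μ ν = ∫⁻ t in Ioi (0 : ℝ), ENNReal.ofReal (1 / (2 * t)) *
      (∫⁻ x, ∫⁻ y, gaussKernel t x y ∂ν ∂μ - ENNReal.ofReal (Real.exp (-t))) := by
  have hm : Measurable fun p : (ℝ × Space) × Space => ENNReal.ofReal (1 / (2 * p.1.1)) *
      (gaussKernel p.1.1 p.1.2 p.2 - ENNReal.ofReal (Real.exp (-p.1.1))) := by
    refine Measurable.mul (Measurable.ennreal_ofReal (by fun_prop)) (Measurable.sub ?_
      (Measurable.ennreal_ofReal (by fun_prop)))
    fun_prop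
  have h1 : mutualEnergy μ ν = ∫⁻ x, ∫⁻ y, (∫⁻ t in Ioi (0 : ℝ), ENNReal.ofReal (1 / (2 * t)) *
      (gaussKernel t x y - ENNReal.ofReal (Real.exp (-t)))) ∂ν ∂μ := by
    refine lintegral_congr_ae ?_
    filter_upwards [hμ] with x hx
    refine lintegral_congr_ae ?_
    filter_upwards [hν] with y hy
    exact coulomb_eq_lintegral_gaussKernel (dist_le_one hx hy)
  have h2 : ∀ x, ∫⁻ y, (∫⁻ t in Ioi (0 : ℝ), ENNReal.ofReal (1 / (2 * t)) *
      (gaussKernel t x y - ENNReal.ofReal (Real.exp (-t)))) ∂ν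
      = ∫⁻ t in Ioi (0 : ℝ), ∫⁻ y, ENNReal.ofReal (1 / (2 * t)) *
      (gaussKernel t x y - ENNReal.ofReal (Real.exp (-t))) ∂ν := by
    intro x
    refine lintegral_lintegral_swap (Measurable.aemeasurable ?_)
    exact hm.comp (by fun_prop : Measurable fun p : Space × ℝ => ((p.2, x), p.1))
  simp_rw [h1, h2]
  rw [lintegral_lintegral_swap]
  · refine setLIntegral_congr_fun measurableSet_Ioi fun t ht => ?_
    have ht : 0 < t := ht
    have hc : ∀ x, ∫⁻ y, ENNReal.ofReal (1 / (2 * t)) *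
        (gaussKernel t x y - ENNReal.ofReal (Real.exp (-t))) ∂ν
        = ENNReal.ofReal (1 / (2 * t)) *
          ∫⁻ y, (gaussKernel t x y - ENNReal.ofReal (Real.exp (-t))) ∂ν := fun x =>
      lintegral_const_mul' _ _ (by simp)
    simp_rw [hc]
    rw [lintegral_const_mul' _ _ (by simp)]
    congr 1
    have hle : ∀ x ∈ sphere, ∀ y ∈ sphere, ENNReal.ofReal (Real.exp (-t)) ≤ gaussKernel t x y := by
      intro x hx y hy
      refine ENNReal.ofReal_le_ofReal (Real.exp_le_exp.2 ?_)
      have := pow_le_one₀ (n := 2) dist_nonneg (dist_le_one hx hy)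
      nlinarith
    have hi : ∀ x ∈ sphere, ∫⁻ y, (gaussKernel t x y - ENNReal.ofReal (Real.exp (-t))) ∂ν
        = ∫⁻ y, gaussKernel t x y ∂ν - ENNReal.ofReal (Real.exp (-t)) := by
      intro x hx
      rw [lintegral_sub measurable_const (by simp)]
      · simp
      · filter_upwards [hν] with y hy using hle x hx y hy
    have : ∫⁻ x, ∫⁻ y, (gaussKernel t x y - ENNReal.ofReal (Real.exp (-t))) ∂ν ∂μ
        = ∫⁻ x, (∫⁻ y, gaussKernel t x y ∂ν - ENNReal.ofReal (Real.exp (-t))) ∂μ := by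
      refine lintegral_congr_ae ?_
      filter_upwards [hμ] with x hx using hi x hx
    rw [this, lintegral_sub measurable_const (by simp)]
    · simp
    · filter_upwards [hμ] with x hx
      calc ENNReal.ofReal (Real.exp (-t)) = ∫⁻ _, ENNReal.ofReal (Real.exp (-t)) ∂ν := by simp
        _ ≤ _ := by
          refine lintegral_mono_ae ?_
          filter_upwards [hν] with y hy using hle x hx y hy
  · refine Measurable.aemeasurable ?_
    have : Measurable fun q : ℝ × Space => ∫⁻ y, ENNReal.ofReal (1 / (2 * q.1)) *
      (gaussKernel q.1 q.2 y - ENNReal.ofReal (Real.exp (-q.1))) ∂ν := hm.lintegral_prod_right'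
    exact this.comp measurable_swap

theorem two_mul_sub_le_sub_add_sub {a b c e : ENNReal} (he : e ≠ ⊤) (hb : e ≤ b) (hc : e ≤ c)
    (h : 2 * a ≤ b + c) : 2 * (a - e) ≤ (b - e) + (c - e) := by
  rw [← ENNReal.add_le_add_iff_right (ENNReal.mul_ne_top (by simp : (2 : ENNReal) ≠ ⊤) he)]
  have hrw : b - e + (c - e) + 2 * e = b + c := by
    calc b - e + (c - e) + 2 * e = (b - e + e) + (c - e + e) := by ring
      _ = b + c := by rw [tsub_add_cancel_of_le hb, tsub_add_cancel_of_le hc]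
  rw [hrw, ← mul_add]
  rcases le_total e a with hea | hea
  · rwa [tsub_add_cancel_of_le hea]
  · rw [tsub_eq_zero_of_le hea, zero_add, two_mul]
    exact add_le_add hb hc

/-- The logarithmic energy is positive semidefinite on differences of probability measures. -/
theorem two_mul_mutualEnergy_le (μ ν : Measure Space) [IsProbabilityMeasure μ]
    [IsProbabilityMeasure ν] (hμ : ∀ᵐ x ∂μ, x ∈ sphere) (hν : ∀ᵐ x ∂ν, x ∈ sphere) :
    2 * mutualEnergy μ ν ≤ mutualEnergy μ μ + mutualEnergy ν ν := by
  have hle : ∀ κ : Measure Space, IsProbabilityMeasure κ → (∀ᵐ x ∂κ, x ∈ sphere) →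
      ∀ t : ℝ, 0 < t →
      ENNReal.ofReal (Real.exp (-t)) ≤ ∫⁻ x, ∫⁻ y, gaussKernel t x y ∂κ ∂κ := by
    intro κ _ hκ t ht
    calc ENNReal.ofReal (Real.exp (-t))
        = ∫⁻ _, ∫⁻ _, ENNReal.ofReal (Real.exp (-t)) ∂κ ∂κ := by simp
      _ ≤ _ := by
        refine lintegral_mono_ae ?_
        filter_upwards [hκ] with x hx
        refine lintegral_mono_ae ?_
        filter_upwards [hκ] with y hy
        refine ENNReal.ofReal_le_ofReal (Real.exp_le_exp.2 ?_)
        have := pow_le_one₀ (n := 2) dist_nonneg (dist_le_one hx hy)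
        nlinarith
  have hmeas : ∀ κ : Measure Space, IsProbabilityMeasure κ → Measurable fun t : ℝ =>
      ENNReal.ofReal (1 / (2 * t)) *
      (∫⁻ x, ∫⁻ y, gaussKernel t x y ∂κ ∂κ - ENNReal.ofReal (Real.exp (-t))) := by
    intro κ _
    refine Measurable.mul (Measurable.ennreal_ofReal (by fun_prop)) (Measurable.sub ?_
      (Measurable.ennreal_ofReal (by fun_prop)))
    have h1 : Measurable fun p : ℝ × Space => ∫⁻ y, gaussKernel p.1 p.2 y ∂κ := by
      have : Measurable fun p : (ℝ × Space) × Space => gaussKernel p.1.1 p.1.2 p.2 := by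
        fun_prop
      exact this.lintegral_prod_right'
    exact h1.lintegral_prod_right'
  rw [mutualEnergy_eq_lintegral_gaussKernel μ ν hμ hν,
    mutualEnergy_eq_lintegral_gaussKernel μ μ hμ hμ,
    mutualEnergy_eq_lintegral_gaussKernel ν ν hν hν,
    ← lintegral_add_left (hmeas μ inferInstance), ← lintegral_const_mul' _ _ (by simp)]
  refine setLIntegral_mono' measurableSet_Ioi fun t ht => ?_
  rw [← mul_add, mul_left_comm]
  gcongr
  exact two_mul_sub_le_sub_add_sub (by simp) (hle μ inferInstance hμ t ht)
    (hle ν inferInstance hν t ht) (two_mul_lintegral_gaussKernel_le ht μ ν)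

/-! ### Rotation invariant charges in polar coordinates -/

/-- The uniform probability distribution of the azimuthal angle. -/
noncomputable def azimuth : Measure ℝ :=
  ((volume : Measure ℝ).restrict (Set.Icc 0 (2 * Real.pi))).withDensity
    fun _ => ENNReal.ofReal (1 / (2 * Real.pi))

/-- The rotation invariant distribution on the sphere with the given law of the polar angle. -/
noncomputable def ringMeasure (m : Measure ℝ) : Measure Space := (m.prod azimuth).map spherePoint

/-- The law of the polar angle under the uniform distribution, restricted to `[a, b]`. -/
noncomputable def band (a b : ℝ) : Measure ℝ :=
  ((volume : Measure ℝ).restrict (Set.Icc a b)).withDensity fun θ => ENNReal.ofReal (Real.sin θ / 2)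

instance : SFinite azimuth := by unfold azimuth; infer_instance

instance (a b : ℝ) : SFinite (band a b) := by unfold band; infer_instance

theorem lintegral_azimuth (f : ℝ → ENNReal) :
    ∫⁻ φ, f φ ∂azimuth
      = ENNReal.ofReal (1 / (2 * Real.pi)) * ∫⁻ φ in Set.Ioc 0 (2 * Real.pi), f φ := by
  rw [azimuth, withDensity_const, lintegral_smul_measure, ← restrict_Ioc_eq_restrict_Icc]
  rfl

instance : IsProbabilityMeasure azimuth := by
  refine ⟨?_⟩
  have h := lintegral_azimuth fun _ => 1
  rw [lintegral_one] at h
  have hp := Real.pi_pos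
  rw [h, lintegral_one, Measure.restrict_apply_univ, Real.volume_Ioc,
    ← ENNReal.ofReal_mul (by positivity)]
  rw [sub_zero, one_div_mul_cancel (by positivity), ENNReal.ofReal_one]

@[fun_prop]
theorem measurable_spherePoint : Measurable spherePoint := by
  unfold spherePoint
  refine (WithLp.measurable_toLp _ _).comp (measurable_pi_iff.2 fun i => ?_)
  fin_cases i <;> simp <;> fun_prop

theorem uniformCharge_eq : uniformCharge = ringMeasure (band 0 Real.pi) := by
  have hp := Real.pi_pos
  rw [uniformCharge, ringMeasure, band, azimuth, prod_withDensity (by fun_prop) (by fun_prop),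
    Measure.prod_restrict, ← Measure.volume_eq_prod]
  congr 2
  ext p
  rw [← ENNReal.ofReal_mul' (by positivity)]
  congr 1
  field_simp; norm_num

@[fun_prop]
theorem measurable_coulomb : Measurable fun p : Space × Space => coulomb p.1 p.2 := by
  unfold coulomb
  refine Measurable.ite (measurableSet_eq_fun measurable_fst measurable_snd) measurable_const ?_
  exact Measurable.ennreal_ofReal (by fun_prop)

/-- The potential at `x` of the uniform unit charge on the circle with polar angle `θ`. -/
noncomputable def ringPotential (x : Space) (θ : ℝ) : ENNReal :=
  ∫⁻ φ, coulomb x (spherePoint (θ, φ)) ∂azimuth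

theorem measurable_ringPotential (x : Space) : Measurable (ringPotential x) := by
  have : Measurable fun p : ℝ × ℝ => coulomb x (spherePoint p) :=
    measurable_coulomb.comp (measurable_const.prodMk measurable_spherePoint)
  exact this.lintegral_prod_right'

theorem lintegral_ringMeasure (m : Measure ℝ) [SFinite m] {f : Space → ENNReal}
    (hf : Measurable f) :
    ∫⁻ x, f x ∂ringMeasure m = ∫⁻ θ, ∫⁻ φ, f (spherePoint (θ, φ)) ∂azimuth ∂m := by
  rw [ringMeasure, lintegral_map hf measurable_spherePoint, lintegral_prod _
    (by exact (hf.comp measurable_spherePoint).aemeasurable)]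

theorem potential_ringMeasure (m : Measure ℝ) [SFinite m] (x : Space) :
    ∫⁻ y, coulomb x y ∂ringMeasure m = ∫⁻ θ, ringPotential x θ ∂m :=
  lintegral_ringMeasure m (measurable_coulomb.comp measurable_prodMk_left)

/-! ### The potential of a circle -/

theorem dist_spherePoint_sq (p q : ℝ × ℝ) :
    dist (spherePoint p) (spherePoint q) ^ 2 =
      (1 - Real.cos p.1 * Real.cos q.1
        - Real.sin p.1 * Real.sin q.1 * Real.cos (p.2 - q.2)) / 2 := by
  rw [EuclideanSpace.dist_eq, Real.sq_sqrt (by positivity), Fin.sum_univ_three]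
  simp only [Real.dist_eq, sq_abs, spherePoint, Real.cos_sub]
  simp
  linear_combination (Real.sin_sq_add_cos_sq p.2 * Real.sin p.1 ^ 2 + Real.sin_sq_add_cos_sq p.1
    + Real.sin_sq_add_cos_sq q.2 * Real.sin q.1 ^ 2 + Real.sin_sq_add_cos_sq q.1) / 4

theorem norm_circleMap_sub_circleMap_sq (R S φ ψ : ℝ) :
    ‖circleMap 0 R φ - circleMap 0 S ψ‖ ^ 2 = R ^ 2 + S ^ 2 - 2 * R * S * Real.cos (φ - ψ) := by
  have h : ∀ R φ, circleMap 0 R φ = ⟨R * Real.cos φ, R * Real.sin φ⟩ := by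
    intro R φ
    apply Complex.ext <;> simp [circleMap, Complex.exp_ofReal_mul_I_re, Complex.exp_ofReal_mul_I_im]
  rw [h, h, ← Complex.normSq_eq_norm_sq, Complex.normSq_apply, Real.cos_sub]
  simp only [Complex.sub_re, Complex.sub_im]
  linear_combination (R ^ 2 * Real.sin_sq_add_cos_sq φ + S ^ 2 * Real.sin_sq_add_cos_sq ψ)

/-- The chord length in terms of half angles. -/
theorem dist_spherePoint (p q : ℝ × ℝ) :
    dist (spherePoint p) (spherePoint q) =
      ‖circleMap 0 (Real.cos (p.1 / 2) * Real.sin (q.1 / 2)) q.2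
        - circleMap 0 (Real.sin (p.1 / 2) * Real.cos (q.1 / 2)) p.2‖ := by
  rw [← sq_eq_sq₀ dist_nonneg (norm_nonneg _), dist_spherePoint_sq,
    norm_circleMap_sub_circleMap_sq, ← Real.cos_neg (q.2 - p.2), neg_sub]
  have hc : ∀ t : ℝ, Real.cos t = 2 * Real.cos (t / 2) ^ 2 - 1 := fun t => by
    rw [← Real.cos_two_mul]; congr 1; ring
  have hs : ∀ t : ℝ, Real.sin t = 2 * Real.sin (t / 2) * Real.cos (t / 2) := fun t => by
    rw [← Real.sin_two_mul]; congr 1; ring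
  rw [hc p.1, hc q.1, hs p.1, hs q.1, mul_pow, mul_pow, Real.sin_sq, Real.sin_sq]
  ring

theorem spherePoint_mem_sphere (p : ℝ × ℝ) : spherePoint p ∈ sphere := by
  rw [sphere, mem_sphere_zero_iff_norm, ← sq_eq_sq₀ (norm_nonneg _) (by norm_num),
    EuclideanSpace.norm_sq_eq, Fin.sum_univ_three]
  simp only [spherePoint, Real.norm_eq_abs, sq_abs]
  simp
  linear_combination (Real.sin_sq_add_cos_sq p.2 * Real.sin p.1 ^ 2
    + Real.sin_sq_add_cos_sq p.1) / 4

/-- The chord is a distance between points of two plane circles about 0, so the ring potential is a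
circle average of log‖z - w‖. For polar angles in [0, π] the excluded case R = S = 0 is that of two
coinciding poles, where the potential is infinite. -/
theorem ringPotential_eq_circleAverage {R S : ℝ} (θ φ θ' : ℝ)
    (hR : R = Real.cos (θ / 2) * Real.sin (θ' / 2)) (hS : S = Real.sin (θ / 2) * Real.cos (θ' / 2))
    (h : R ≠ 0 ∨ S ≠ 0) :
    ringPotential (spherePoint (θ, φ)) θ'
      = ENNReal.ofReal (-Real.circleAverage (fun z => Real.log ‖z - circleMap 0 S φ‖) 0 R) := by
  have hp := Real.pi_pos
  have hd : ∀ ψ, dist (spherePoint (θ, φ)) (spherePoint (θ', ψ))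
      = ‖circleMap 0 R ψ - circleMap 0 S φ‖ := by
    intro ψ; rw [dist_spherePoint, hR, hS]
  -- `coulomb` is infinite on the diagonal while `Real.log 0 = 0`; the two integrands differ only on
  -- a null set of angles.
  have hne : ∀ᵐ ψ : ℝ, circleMap 0 R ψ ≠ circleMap 0 S φ := by
    by_cases hR0 : R = 0
    · refine Eventually.of_forall fun ψ => ?_
      have hS0 := h.resolve_left (not_not.2 hR0)
      simp [hR0, circleMap, eq_comm, hS0]
    · exact ((Set.countable_singleton (circleMap 0 S φ)).preimage_circleMap 0 hR0).ae_notMem _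
  have h1 : ∫⁻ ψ in Set.Ioc 0 (2 * Real.pi), coulomb (spherePoint (θ, φ)) (spherePoint (θ', ψ))
      = ∫⁻ ψ in Set.Ioc 0 (2 * Real.pi),
        ENNReal.ofReal (-Real.log ‖circleMap 0 R ψ - circleMap 0 S φ‖) := by
    refine lintegral_congr_ae ?_
    filter_upwards [ae_restrict_of_ae hne] with ψ hψ
    rw [coulomb, if_neg, hd]
    intro he
    have := hd ψ
    rw [he, dist_self, eq_comm, norm_eq_zero, sub_eq_zero] at this
    exact hψ this
  have hint : IntervalIntegrable (fun ψ => Real.log ‖circleMap 0 R ψ - circleMap 0 S φ‖) volume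
      0 (2 * Real.pi) := circleIntegrable_log_norm_sub_const (a := circleMap 0 S φ) (c := 0) R
  rw [ringPotential, lintegral_azimuth, h1, ← ofReal_integral_eq_lintegral_ofReal,
    ← ENNReal.ofReal_mul (by positivity), ← intervalIntegral.integral_of_le (by positivity),
    Real.circleAverage_def, intervalIntegral.integral_neg, smul_eq_mul, one_div, mul_neg]
  · exact ((intervalIntegrable_iff_integrableOn_Ioc_of_le (by positivity)).1 hint).neg
  · refine Eventually.of_forall fun ψ => ?_
    simp only [Pi.zero_apply, ← hd]
    exact neg_nonneg.2 (Real.log_nonpos dist_nonneg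
      (dist_le_one (spherePoint_mem_sphere _) (spherePoint_mem_sphere _)))

theorem log_cos_half {θ : ℝ} : Real.log (Real.cos (θ / 2)) = Real.log ((1 + Real.cos θ) / 2) / 2 := by
  have : (1 + Real.cos θ) / 2 = Real.cos (θ / 2) ^ 2 := by
    rw [Real.cos_sq, mul_div_cancel₀ _ two_ne_zero]; ring
  rw [this, Real.log_pow]; push_cast; ring

theorem log_sin_half {θ : ℝ} : Real.log (Real.sin (θ / 2)) = Real.log ((1 - Real.cos θ) / 2) / 2 := by
  have : (1 - Real.cos θ) / 2 = Real.sin (θ / 2) ^ 2 := by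
    rw [Real.sin_sq, Real.cos_sq, mul_div_cancel₀ _ two_ne_zero]; ring
  rw [this, Real.log_pow]; push_cast; ring

theorem norm_circleMap_zero_center (S φ : ℝ) : ‖circleMap 0 S φ‖ = |S| := by simp

/-- The potential of a circle, seen from a point on its north side. -/
theorem ringPotential_of_le {θ θ' : ℝ} (φ : ℝ) (h0 : 0 ≤ θ) (h : θ ≤ θ') (hpi : θ' ≤ Real.pi)
    (hθ : θ < Real.pi) (hθ' : 0 < θ') :
    ringPotential (spherePoint (θ, φ)) θ' =
      ENNReal.ofReal
        (-(Real.log ((1 + Real.cos θ) / 2) + Real.log ((1 - Real.cos θ') / 2)) / 2) := by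
  have hc : 0 < Real.cos (θ / 2) := Real.cos_pos_of_mem_Ioo ⟨by linarith, by linarith⟩
  have hs : 0 < Real.sin (θ' / 2) := Real.sin_pos_of_pos_of_lt_pi (by linarith) (by linarith)
  have hc' : 0 ≤ Real.cos (θ' / 2) := Real.cos_nonneg_of_mem_Icc ⟨by linarith, by linarith⟩
  have hs' : 0 ≤ Real.sin (θ / 2) := Real.sin_nonneg_of_nonneg_of_le_pi (by linarith) (by linarith)
  -- After expansion this says S ≤ R: the point lies in the closed disc, where the average is log R.
  have hd : 0 ≤ Real.sin (θ' / 2 - θ / 2) :=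
    Real.sin_nonneg_of_nonneg_of_le_pi (by linarith) (by linarith)
  rw [Real.sin_sub] at hd
  rw [ringPotential_eq_circleAverage θ φ θ' rfl rfl (Or.inl (by positivity)),
    circleAverage_log_norm_sub_const_of_mem_closedBall, Real.log_mul hc.ne' hs.ne',
    log_cos_half, log_sin_half]
  · congr 1; ring
  · rw [mem_closedBall_zero_iff, norm_circleMap_zero_center, abs_of_nonneg (by positivity),
      abs_of_nonneg (by positivity)]
    linarith

/-- The potential of a circle, seen from a point on its south side. -/
theorem ringPotential_of_ge {θ θ' : ℝ} (φ : ℝ) (h0 : 0 ≤ θ') (h : θ' ≤ θ) (hpi : θ ≤ Real.pi)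
    (hθ : 0 < θ) (hθ' : θ' < Real.pi) :
    ringPotential (spherePoint (θ, φ)) θ' =
      ENNReal.ofReal
        (-(Real.log ((1 - Real.cos θ) / 2) + Real.log ((1 + Real.cos θ') / 2)) / 2) := by
  have hc : 0 < Real.cos (θ' / 2) := Real.cos_pos_of_mem_Ioo ⟨by linarith, by linarith⟩
  have hs : 0 < Real.sin (θ / 2) := Real.sin_pos_of_pos_of_lt_pi (by linarith) (by linarith)
  have hc' : 0 ≤ Real.cos (θ / 2) := Real.cos_nonneg_of_mem_Icc ⟨by linarith, by linarith⟩
  have hs' : 0 ≤ Real.sin (θ' / 2) := Real.sin_nonneg_of_nonneg_of_le_pi (by linarith) (by linarith)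
  have hd : 0 ≤ Real.sin (θ / 2 - θ' / 2) :=
    Real.sin_nonneg_of_nonneg_of_le_pi (by linarith) (by linarith)
  rw [Real.sin_sub] at hd
  have havg : Real.circleAverage (fun z => Real.log ‖z - circleMap 0 (Real.sin (θ / 2) *
      Real.cos (θ' / 2)) φ‖) 0 (Real.cos (θ / 2) * Real.sin (θ' / 2))
      = Real.log (Real.sin (θ / 2) * Real.cos (θ' / 2)) := by
    -- Here R ≤ S and the average is log S. The circle degenerates to its centre when R = 0;
    -- otherwise log R + log⁺(S / R) = log S.
    rcases (mul_nonneg hc' hs').eq_or_lt with hR | hR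
    · rw [← hR, Real.circleAverage_zero, zero_sub, norm_neg, norm_circleMap_zero_center,
        abs_of_pos (by positivity)]
    · rw [circleAverage_log_norm_sub_const_eq_log_radius_add_posLog hR.ne', zero_sub, norm_neg,
        norm_circleMap_zero_center, abs_of_pos (by positivity), Real.posLog_eq_log,
        ← Real.log_mul hR.ne' (by positivity), mul_inv_cancel_left₀ hR.ne']
      rw [abs_of_pos (by positivity), ← div_eq_inv_mul, le_div_iff₀ hR]
      linarith
  rw [ringPotential_eq_circleAverage θ φ θ' rfl rfl (Or.inr (by positivity)), havg,
    Real.log_mul hs.ne' hc.ne', log_cos_half, log_sin_half]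
  congr 1; ring

/-! ### The potential of a band -/

-- Nonnegativity of the derivative yields its integrability, so logarithmic singularities at the
-- endpoints are harmless. The sign of the increment is kept for later sums of `ENNReal.ofReal`.
open Set in
theorem lintegral_deriv_of_nonneg {f f' : ℝ → ℝ} {a b : ℝ} (hab : a ≤ b)
    (hf : ContinuousOn f (Icc a b)) (hd : ∀ x ∈ Ioo a b, HasDerivAt f (f' x) x)
    (hpos : ∀ x ∈ Ioo a b, 0 ≤ f' x) :
    0 ≤ f b - f a ∧ ∫⁻ x in Icc a b, ENNReal.ofReal (f' x) = ENNReal.ofReal (f b - f a) := by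
  have hi : IntervalIntegrable f' volume a b := by
    apply intervalIntegral.intervalIntegrable_deriv_of_nonneg (g := f)
    · rwa [uIcc_of_le hab]
    · rwa [min_eq_left hab, max_eq_right hab]
    · rwa [min_eq_left hab, max_eq_right hab]
  have he := intervalIntegral.integral_eq_sub_of_hasDerivAt_of_le hab hf hd hi
  have hpos' : 0 ≤ᵐ[volume.restrict (Ioc a b)] f' := by
    rw [← restrict_Ioo_eq_restrict_Ioc]
    filter_upwards [ae_restrict_mem measurableSet_Ioo] with x hx using hpos x hx
  rw [← he, intervalIntegral.integral_of_le hab, ← restrict_Ioc_eq_restrict_Icc,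
    ofReal_integral_eq_lintegral_ofReal ((intervalIntegrable_iff_integrableOn_Ioc_of_le hab).1 hi)
      hpos']
  exact ⟨integral_nonneg_of_ae hpos', rfl⟩

/-- An antiderivative of `-(log u + log q) / 2` in `u`. -/
noncomputable def bandTerm (q u : ℝ) : ℝ := -(u * Real.log u + u * Real.log q - u) / 2

theorem continuous_bandTerm (q : ℝ) : Continuous (bandTerm q) := by
  have := Real.continuous_mul_log
  unfold bandTerm
  fun_prop

theorem hasDerivAt_bandTerm (q : ℝ) {u : ℝ} (hu : u ≠ 0) :
    HasDerivAt (bandTerm q) (-(Real.log q + Real.log u) / 2) u := by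
  have h := (((Real.hasDerivAt_mul_log hu).add ((hasDerivAt_id u).mul_const (Real.log q))).sub
    (hasDerivAt_id u)).neg.div_const 2
  refine h.congr_deriv ?_
  ring

open Set in
theorem lintegral_band (a b : ℝ) (f : ℝ → ENNReal) (hf : Measurable f) :
    ∫⁻ θ, f θ ∂band a b = ∫⁻ θ in Icc a b, ENNReal.ofReal (Real.sin θ / 2) * f θ := by
  rw [band, lintegral_withDensity_eq_lintegral_mul _ (by fun_prop) hf]
  rfl

theorem neg_log_add_log_nonneg {s t : ℝ} (hs : -1 ≤ s) (hs1 : s ≤ 1) (ht : -1 ≤ t) (ht1 : t ≤ 1) :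
    0 ≤ -(Real.log ((1 + s) / 2) + Real.log ((1 - t) / 2)) / 2 := by
  have h1 := Real.log_nonpos (by linarith : 0 ≤ (1 + s) / 2) (by linarith)
  have h2 := Real.log_nonpos (by linarith : 0 ≤ (1 - t) / 2) (by linarith)
  linarith

open Set in
/-- The potential of a band of uniform charge, seen from its north side. -/
theorem bandPotential_of_le {θ a b : ℝ} (φ : ℝ) (h0 : 0 ≤ θ) (ha : θ ≤ a) (hab : a ≤ b)
    (hb : b ≤ Real.pi) :
    0 ≤ bandTerm ((1 + Real.cos θ) / 2) ((1 - Real.cos b) / 2)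
        - bandTerm ((1 + Real.cos θ) / 2) ((1 - Real.cos a) / 2) ∧
    ∫⁻ θ', ringPotential (spherePoint (θ, φ)) θ' ∂band a b
      = ENNReal.ofReal (bandTerm ((1 + Real.cos θ) / 2) ((1 - Real.cos b) / 2)
        - bandTerm ((1 + Real.cos θ) / 2) ((1 - Real.cos a) / 2)) := by
  set q := (1 + Real.cos θ) / 2 with hq
  have hsin : ∀ x ∈ Ioo a b, 0 < Real.sin x := fun x hx =>
    Real.sin_pos_of_pos_of_lt_pi (by linarith [hx.1]) (by linarith [hx.2])
  -- In u = (1 - cos x)/2 the uniform charge is Lebesgue measure (Archimedes), so `bandTerm`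
  -- composed with u is an antiderivative.
  have key := lintegral_deriv_of_nonneg
    (f := fun x => bandTerm q ((1 - Real.cos x) / 2))
    (f' := fun x => Real.sin x / 2 * (-(Real.log q + Real.log ((1 - Real.cos x) / 2)) / 2)) hab
    ((continuous_bandTerm q).comp (by fun_prop)).continuousOn ?_ ?_
  · refine ⟨key.1, ?_⟩
    rw [← key.2, lintegral_band _ _ _ (measurable_ringPotential _),
      ← restrict_Ioo_eq_restrict_Icc]
    refine setLIntegral_congr_fun measurableSet_Ioo fun x hx => ?_
    rw [ringPotential_of_le φ h0 (ha.trans hx.1.le) (hx.2.le.trans hb)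
      (by linarith [hx.1, hx.2]) (by linarith [hx.1]),
      ← ENNReal.ofReal_mul (by linarith [hsin x hx])]
  · intro x hx
    have hu : (1 - Real.cos x) / 2 ≠ 0 := by
      have h2 := hsin x hx
      have h1 := Real.sin_sq_add_cos_sq x
      nlinarith
    refine ((hasDerivAt_bandTerm q hu).comp x
      (((Real.hasDerivAt_cos x).const_sub 1).div_const 2)).congr_deriv ?_
    ring
  · intro x hx
    exact mul_nonneg (by linarith [hsin x hx]) (neg_log_add_log_nonneg (Real.neg_one_le_cos _)
      (Real.cos_le_one _) (Real.neg_one_le_cos _) (Real.cos_le_one _))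

open Set in
/-- The potential of a band of uniform charge, seen from its south side. -/
theorem bandPotential_of_ge {θ a b : ℝ} (φ : ℝ) (h0 : 0 ≤ a) (hab : a ≤ b) (hb : b ≤ θ)
    (hpi : θ ≤ Real.pi) :
    0 ≤ bandTerm ((1 - Real.cos θ) / 2) ((1 + Real.cos a) / 2)
        - bandTerm ((1 - Real.cos θ) / 2) ((1 + Real.cos b) / 2) ∧
    ∫⁻ θ', ringPotential (spherePoint (θ, φ)) θ' ∂band a b
      = ENNReal.ofReal (bandTerm ((1 - Real.cos θ) / 2) ((1 + Real.cos a) / 2)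
        - bandTerm ((1 - Real.cos θ) / 2) ((1 + Real.cos b) / 2)) := by
  set q := (1 - Real.cos θ) / 2 with hq
  have hsin : ∀ x ∈ Ioo a b, 0 < Real.sin x := fun x hx =>
    Real.sin_pos_of_pos_of_lt_pi (by linarith [hx.1]) (by linarith [hx.2])
  have key := lintegral_deriv_of_nonneg
    (f := fun x => -bandTerm q ((1 + Real.cos x) / 2))
    (f' := fun x => Real.sin x / 2 * (-(Real.log q + Real.log ((1 + Real.cos x) / 2)) / 2)) hab
    ((continuous_bandTerm q).comp (by fun_prop)).neg.continuousOn ?_ ?_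
  · rw [neg_sub_neg] at key
    refine ⟨key.1, ?_⟩
    rw [← key.2, lintegral_band _ _ _ (measurable_ringPotential _),
      ← restrict_Ioo_eq_restrict_Icc]
    refine setLIntegral_congr_fun measurableSet_Ioo fun x hx => ?_
    rw [ringPotential_of_ge φ (h0.trans hx.1.le) (hx.2.le.trans hb) hpi
      (by linarith [hx.1, hx.2]) (by linarith [hx.2]),
      ← ENNReal.ofReal_mul (by linarith [hsin x hx])]
  · intro x hx
    have hu : (1 + Real.cos x) / 2 ≠ 0 := by
      have h2 := hsin x hx
      have h1 := Real.sin_sq_add_cos_sq x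
      nlinarith
    refine ((hasDerivAt_bandTerm q hu).comp x
      (((Real.hasDerivAt_cos x).const_add 1).div_const 2)).neg.congr_deriv ?_
    ring
  · intro x hx
    have := neg_log_add_log_nonneg (Real.neg_one_le_cos x) (Real.cos_le_one x)
      (Real.neg_one_le_cos θ) (Real.cos_le_one θ)
    rw [add_comm] at this
    exact mul_nonneg (by linarith [hsin x hx]) this

theorem band_add_band {a b c : ℝ} (hab : a ≤ b) (hbc : b ≤ c) :
    band a b + band b c = band a c := by
  unfold band
  simp only [← restrict_Ioc_eq_restrict_Icc]
  rw [← withDensity_add_measure, ← Measure.restrict_union (Set.Ioc_disjoint_Ioc_of_le le_rfl)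
    measurableSet_Ioc, Set.Ioc_union_Ioc_eq_Ioc hab hbc]

/-! ### Spherical coordinates and the reflection in the equator -/

theorem exists_spherePoint {x : Space} (hx : x ∈ sphere) :
    ∃ θ φ, 0 ≤ θ ∧ θ ≤ Real.pi ∧ spherePoint (θ, φ) = x ∧ Real.cos θ = 2 * x 2 := by
  have h : x 0 ^ 2 + x 1 ^ 2 + x 2 ^ 2 = 1 / 4 := by
    rw [sphere, mem_sphere_zero_iff_norm] at hx
    have := EuclideanSpace.norm_sq_eq x
    rw [hx, Fin.sum_univ_three] at this
    simp only [Real.norm_eq_abs, sq_abs] at this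
    rw [← this]; norm_num
  have hcos : Real.cos (Real.arccos (2 * x 2)) = 2 * x 2 :=
    Real.cos_arccos (by nlinarith [sq_nonneg (x 0), sq_nonneg (x 1)])
      (by nlinarith [sq_nonneg (x 0), sq_nonneg (x 1)])
  set c : ℂ := ⟨2 * x 0, 2 * x 1⟩ with hc
  have hsin : Real.sin (Real.arccos (2 * x 2)) = ‖c‖ := by
    rw [← sq_eq_sq₀ (Real.sin_nonneg_of_nonneg_of_le_pi (Real.arccos_nonneg _)
      (Real.arccos_le_pi _)) (norm_nonneg _), Real.sin_sq, hcos, ← Complex.normSq_eq_norm_sq,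
      Complex.normSq_apply]
    simp only [hc]
    linear_combination -4 * h
  refine ⟨Real.arccos (2 * x 2), c.arg, Real.arccos_nonneg _, Real.arccos_le_pi _, ?_, hcos⟩
  ext i
  fin_cases i
  · simp [spherePoint, hsin, Complex.norm_mul_cos_arg, hc]
  · simp [spherePoint, hsin, Complex.norm_mul_sin_arg, hc]
  · simp [spherePoint, hcos]

theorem mirror_spherePoint (θ φ : ℝ) :
    mirror (spherePoint (θ, φ)) = spherePoint (Real.pi - θ, φ) := by
  ext i
  fin_cases i <;> simp [mirror, spherePoint]
  ring

@[fun_prop]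
theorem measurable_mirror : Measurable mirror := by
  unfold mirror
  refine (WithLp.measurable_toLp _ _).comp (measurable_pi_iff.2 fun i => ?_)
  fin_cases i <;> simp <;> fun_prop

theorem dist_mirror (x y : Space) : dist (mirror x) (mirror y) = dist x y := by
  rw [EuclideanSpace.dist_eq, EuclideanSpace.dist_eq, Fin.sum_univ_three, Fin.sum_univ_three]
  simp only [mirror, Real.dist_eq, sq_abs]
  simp
  congr 1; ring

theorem coulomb_mirror (x y : Space) : coulomb (mirror x) (mirror y) = coulomb x y := by
  unfold coulomb
  rw [dist_mirror]
  have : mirror x = mirror y ↔ x = y := by rw [← dist_eq_zero, dist_mirror, dist_eq_zero]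
  simp only [this]

theorem potential_mirror {ν : Measure Space} (hν : ν.map mirror = ν) (x : Space) :
    ∫⁻ y, coulomb (mirror x) y ∂ν = ∫⁻ y, coulomb x y ∂ν := by
  conv_lhs => rw [← hν]
  rw [lintegral_map (f := fun y => coulomb (mirror x) y)
    (measurable_coulomb.comp measurable_prodMk_left) measurable_mirror]
  simp only [coulomb_mirror]

theorem map_band (a b : ℝ) :
    (band a b).map (fun θ => Real.pi - θ) = band (Real.pi - b) (Real.pi - a) := by
  ext s hs
  have hT : Measurable fun θ : ℝ => Real.pi - θ := by fun_prop
  rw [Measure.map_apply hT hs, band, band, withDensity_apply _ (hT hs), withDensity_apply _ hs,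
    Measure.restrict_restrict (hT hs), Measure.restrict_restrict hs]
  have h := (Measure.measurePreserving_sub_left (volume : Measure ℝ) Real.pi).setLIntegral_comp_preimage
    (hs.inter measurableSet_Icc) (f := fun θ => ENNReal.ofReal (Real.sin θ / 2)) (by fun_prop)
    (s := s ∩ Set.Icc (Real.pi - b) (Real.pi - a))
  rw [← h]
  simp only [Real.sin_pi_sub]
  congr 2
  ext θ
  simp only [Set.mem_inter_iff, Set.mem_preimage, Set.mem_Icc]
  refine and_congr_right fun _ => ?_
  constructor <;> rintro ⟨h1, h2⟩ <;> constructor <;> linarith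

theorem map_mirror_ringMeasure (m : Measure ℝ) [SFinite m] :
    (ringMeasure m).map mirror = ringMeasure (m.map fun θ => Real.pi - θ) := by
  have h := Measure.map_prod_map m azimuth (f := fun θ : ℝ => Real.pi - θ) (g := id)
    (by fun_prop) measurable_id
  rw [Measure.map_id] at h
  rw [ringMeasure, ringMeasure, h, Measure.map_map measurable_mirror measurable_spherePoint,
    Measure.map_map measurable_spherePoint (by fun_prop)]
  congr 1
  ext1 p
  exact mirror_spherePoint p.1 p.2

theorem band_univ {a b : ℝ} (ha : 0 ≤ a) (hab : a ≤ b) (hb : b ≤ Real.pi) :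
    band a b Set.univ = ENNReal.ofReal ((Real.cos a - Real.cos b) / 2) := by
  have key := lintegral_deriv_of_nonneg (f := fun x => -Real.cos x / 2)
    (f' := fun x => Real.sin x / 2) hab (by fun_prop) ?_ ?_
  · rw [band, withDensity_apply _ MeasurableSet.univ, Measure.restrict_univ, key.2]
    congr 1; ring
  · intro x _
    refine ((Real.hasDerivAt_cos x).neg.div_const 2).congr_deriv ?_
    ring
  · intro x hx
    have := Real.sin_nonneg_of_nonneg_of_le_pi (ha.trans hx.1.le) (hx.2.le.trans hb)
    positivity

theorem band_cos_eq_zero (a b : ℝ) : band a b {θ | Real.cos θ = 0} = 0 := by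
  have hc : {θ : ℝ | Real.cos θ = 0}.Countable := by
    refine (Set.countable_range fun k : ℤ => (2 * k + 1) * Real.pi / 2).mono fun θ hθ => ?_
    obtain ⟨k, hk⟩ := Real.cos_eq_zero_iff.1 hθ
    exact ⟨k, hk.symm⟩
  have h : volume.restrict (Set.Icc a b) {θ : ℝ | Real.cos θ = 0} = 0 :=
    Measure.absolutelyContinuous_of_le Measure.restrict_le_self (hc.measure_zero volume)
  exact withDensity_absolutelyContinuous _ _ h

theorem lintegral_band_const {a b : ℝ} {f : ℝ → ENNReal} {c : ENNReal}
    (h : ∀ θ ∈ Set.Icc a b, f θ = c) : ∫⁻ θ, f θ ∂band a b = c * band a b Set.univ := by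
  have : ∀ᵐ θ ∂band a b, f θ = c := by
    refine (withDensity_absolutelyContinuous _ _).ae_le ?_
    filter_upwards [ae_restrict_mem measurableSet_Icc] with θ hθ using h θ hθ
  rw [lintegral_congr_ae this, lintegral_const]

/-! ### The equilibrium distribution -/

/-- The law of the polar angle in equilibrium: a charge `α` on the equator, and caps of uniform
density at `|cos θ| ≥ α`. -/
noncomputable def polarLaw (α : ℝ) : Measure ℝ :=
  ENNReal.ofReal α • Measure.dirac (Real.pi / 2)
    + (band 0 (Real.arccos α) + band (Real.pi - Real.arccos α) Real.pi)

instance (α : ℝ) : SFinite (polarLaw α) := by unfold polarLaw; infer_instance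

/-- The equilibrium charge distribution. -/
noncomputable def equilibrium (α : ℝ) : Measure Space := ringMeasure (polarLaw α)

theorem lintegral_polarLaw (α : ℝ) (f : ℝ → ENNReal) :
    ∫⁻ θ, f θ ∂polarLaw α = ENNReal.ofReal α * f (Real.pi / 2)
      + (∫⁻ θ, f θ ∂band 0 (Real.arccos α)
        + ∫⁻ θ, f θ ∂band (Real.pi - Real.arccos α) Real.pi) := by
  rw [polarLaw, lintegral_add_measure, lintegral_add_measure, lintegral_smul_measure,
    lintegral_dirac]
  rfl

theorem map_polarLaw (α : ℝ) : (polarLaw α).map (fun θ => Real.pi - θ) = polarLaw α := by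
  have hT : Measurable fun θ : ℝ => Real.pi - θ := by fun_prop
  rw [polarLaw, Measure.map_add _ _ hT, Measure.map_add _ _ hT, Measure.map_smul, map_band,
    map_band, Measure.map_dirac' hT, sub_self, sub_sub_cancel, sub_zero, sub_half,
    add_comm (band 0 _)]

theorem measurableSet_sphere : MeasurableSet sphere :=
  (Metric.isClosed_sphere (x := (0 : Space)) (ε := 1 / 2)).measurableSet

theorem measurableSet_equator : MeasurableSet equator :=
  measurableSet_sphere.inter (measurableSet_eq_fun (by fun_prop) measurable_const)

theorem ringMeasure_apply (m : Measure ℝ) [SFinite m] {s : Set Space} (hs : MeasurableSet s)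
    {t : Set ℝ} (h : ∀ θ φ, spherePoint (θ, φ) ∈ s ↔ θ ∈ t) : ringMeasure m s = m t := by
  have : spherePoint ⁻¹' s = t ×ˢ Set.univ := by
    ext p; simpa using h p.1 p.2
  rw [ringMeasure, Measure.map_apply measurable_spherePoint hs, this, Measure.prod_prod]
  simp

theorem spherePoint_mem_equator (θ φ : ℝ) :
    spherePoint (θ, φ) ∈ equator ↔ θ ∈ {θ | Real.cos θ = 0} := by
  simp only [equator, Set.mem_ofPred_eq, spherePoint_mem_sphere, true_and]
  simp [spherePoint]

theorem isAdmissible_equilibrium {α : ℝ} (h0 : 0 ≤ α) (h1 : α ≤ 1) :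
    IsAdmissible α (equilibrium α) where
  on_sphere := by
    rw [equilibrium, ringMeasure_apply _ measurableSet_sphere.compl (t := ∅), measure_empty]
    simp [spherePoint_mem_sphere]
  on_equator := by
    rw [equilibrium, ringMeasure_apply _ measurableSet_equator spherePoint_mem_equator, polarLaw]
    simp only [Measure.add_apply, Measure.smul_apply, band_cos_eq_zero]
    rw [Measure.dirac_apply_of_mem (by simp)]
    simp
  on_body := by
    have hb : ∀ a b, band a b {θ | Real.cos θ = 0}ᶜ = band a b Set.univ := fun a b =>
      measure_of_measure_compl_eq_zero (by rw [compl_compl]; exact band_cos_eq_zero a b)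
    have h2 := Real.pi_pos
    have h3 := Real.arccos_nonneg α
    have h4 := Real.arccos_le_pi α
    have hcl : IsClosed {θ | Real.cos θ = 0} := isClosed_eq Real.continuous_cos continuous_const
    rw [equilibrium, ringMeasure_apply _ (measurableSet_sphere.diff measurableSet_equator)
      (t := {θ | Real.cos θ = 0}ᶜ), polarLaw]
    · simp only [Measure.add_apply, Measure.smul_apply, hb]
      rw [band_univ le_rfl h3 h4, band_univ (by linarith) (by linarith) le_rfl,
        Measure.dirac_apply' _ hcl.measurableSet.compl, Real.cos_pi_sub,
        Real.cos_arccos (by linarith) h1, ← ENNReal.ofReal_add]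
      · simp; congr 1; ring
      · rw [Real.cos_zero]; linarith
      · rw [Real.cos_pi]; linarith
    · intro θ φ
      rw [Set.mem_sdiff, spherePoint_mem_equator]
      simp [spherePoint_mem_sphere]
  symmetric := by rw [equilibrium, map_mirror_ringMeasure, map_polarLaw]

theorem IsAdmissible.ae_mem_sphere {α : ℝ} {ν : Measure Space} (h : IsAdmissible α ν) :
    ∀ᵐ x ∂ν, x ∈ sphere := by
  rw [ae_iff]; exact h.on_sphere

theorem IsAdmissible.isProbabilityMeasure {α : ℝ} {ν : Measure Space} (h : IsAdmissible α ν)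
    (h0 : 0 ≤ α) (h1 : α ≤ 1) : IsProbabilityMeasure ν := by
  refine ⟨?_⟩
  rw [← measure_add_measure_compl measurableSet_sphere, h.on_sphere, add_zero,
    ← measure_inter_add_sdiff sphere measurableSet_equator,
    Set.inter_eq_self_of_subset_right (show equator ⊆ sphere from fun x hx => hx.1),
    h.on_equator, h.on_body, ← ENNReal.ofReal_add h0 (by linarith)]
  simp

/-! ### The equilibrium potential -/

/-- The uniform charge has constant potential `1 / 2` on the sphere. -/
theorem potential_uniformCharge {x : Space} (hx : x ∈ sphere) :
    ∫⁻ y, coulomb x y ∂uniformCharge = ENNReal.ofReal (1 / 2) := by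
  obtain ⟨θ, φ, h0, hpi, rfl, -⟩ := exists_spherePoint hx
  have ha := bandPotential_of_ge φ le_rfl h0 le_rfl hpi
  have hb := bandPotential_of_le φ h0 le_rfl hpi le_rfl
  rw [uniformCharge_eq, potential_ringMeasure, ← band_add_band h0 hpi, lintegral_add_measure,
    ha.2, hb.2, ← ENNReal.ofReal_add ha.1 hb.1]
  congr 1
  simp only [bandTerm, Real.cos_zero, Real.cos_pi]
  norm_num
  ring

/-- The value of the equilibrium potential on the caps. -/
noncomputable def capValue (α : ℝ) : ℝ :=
  1 / 2 + ((1 + α) / 2 * Real.log ((1 + α) / 2) - (1 - α) / 2 * Real.log ((1 - α) / 2) - α) / 2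
    + α / 2 * Real.log 2

/-- The value of the equilibrium potential on the equator. -/
noncomputable def ringValue (α : ℝ) : ℝ :=
  (1 - α) / 2 + (1 + α) / 2 * Real.log ((1 + α) / 2) + (1 + α) / 2 * Real.log 2

theorem potential_equilibrium (α : ℝ) (x : Space) :
    ∫⁻ y, coulomb x y ∂equilibrium α = ENNReal.ofReal α * ringPotential x (Real.pi / 2)
      + (∫⁻ θ, ringPotential x θ ∂band 0 (Real.arccos α)
        + ∫⁻ θ, ringPotential x θ ∂band (Real.pi - Real.arccos α) Real.pi) := by
  rw [equilibrium, potential_ringMeasure, lintegral_polarLaw]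

theorem ringPotential_equator {θ : ℝ} (φ : ℝ) (h0 : 0 ≤ θ) (h : θ ≤ Real.pi / 2) :
    0 ≤ (Real.log 2 - Real.log ((1 + Real.cos θ) / 2)) / 2 ∧
    ringPotential (spherePoint (θ, φ)) (Real.pi / 2) =
      ENNReal.ofReal ((Real.log 2 - Real.log ((1 + Real.cos θ) / 2)) / 2) := by
  have hp := Real.pi_pos
  constructor
  · have h1 := Real.log_nonpos (by linarith [Real.neg_one_le_cos θ] : 0 ≤ (1 + Real.cos θ) / 2)
      (by linarith [Real.cos_le_one θ])
    have h2 := Real.log_nonneg (by norm_num : (1 : ℝ) ≤ 2)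
    linarith
  · rw [ringPotential_of_le φ h0 h (by linarith) (by linarith) (by linarith), Real.cos_pi_div_two,
      sub_zero, one_div, Real.log_inv]
    congr 1; ring

/-- Splitting the near cap at θ puts each piece of charge on one side of the point; the coefficients
of log((1 ± cos θ)/2) then add up to zero. -/
theorem potential_equilibrium_cap {α θ : ℝ} (φ : ℝ) (hα : 0 ≤ α) (hα1 : α ≤ 1) (h0 : 0 ≤ θ)
    (h : θ ≤ Real.arccos α) :
    ∫⁻ y, coulomb (spherePoint (θ, φ)) y ∂equilibrium α = ENNReal.ofReal (capValue α) := by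
  have hp := Real.pi_pos
  have h2 : Real.arccos α ≤ Real.pi / 2 := Real.arccos_le_pi_div_two.2 hα
  have hr := ringPotential_equator φ h0 (h.trans h2)
  have ha := bandPotential_of_ge φ le_rfl h0 le_rfl (by linarith)
  have hb := bandPotential_of_le φ h0 le_rfl h (by linarith)
  have hc := bandPotential_of_le φ h0 (by linarith : θ ≤ Real.pi - Real.arccos α)
    (by linarith [Real.arccos_nonneg α]) le_rfl
  rw [potential_equilibrium, ← band_add_band h0 h, lintegral_add_measure, hr.2, ha.2, hb.2, hc.2,
    ← ENNReal.ofReal_mul hα, ← ENNReal.ofReal_add ha.1 hb.1,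
    ← ENNReal.ofReal_add (add_nonneg ha.1 hb.1) hc.1, ← ENNReal.ofReal_add (mul_nonneg hα hr.1)
    (add_nonneg (add_nonneg ha.1 hb.1) hc.1)]
  congr 1
  simp only [bandTerm, capValue, Real.cos_zero, Real.cos_pi, Real.cos_pi_sub,
    Real.cos_arccos (by linarith : -1 ≤ α) hα1]
  norm_num
  ring

/-- The excess over `capValue α` is half the relative entropy of the weights (1 ± α)/2 with respect
to (1 ± cos θ)/2. -/
theorem potential_equilibrium_gap {α θ : ℝ} (φ : ℝ) (hα : 0 ≤ α) (hα1 : α ≤ 1)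
    (h0 : Real.arccos α ≤ θ) (h : θ ≤ Real.pi / 2) :
    ∫⁻ y, coulomb (spherePoint (θ, φ)) y ∂equilibrium α = ENNReal.ofReal (capValue α
      + ((1 + α) / 2 * (Real.log ((1 + α) / 2) - Real.log ((1 + Real.cos θ) / 2))
        + (1 - α) / 2 * (Real.log ((1 - α) / 2) - Real.log ((1 - Real.cos θ) / 2))) / 2) := by
  have hp := Real.pi_pos
  have hn := Real.arccos_nonneg α
  have hr := ringPotential_equator φ (hn.trans h0) h
  have hb := bandPotential_of_ge φ le_rfl hn h0 (by linarith)
  have hc := bandPotential_of_le φ (hn.trans h0) (by linarith : θ ≤ Real.pi - Real.arccos α)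
    (by linarith [Real.arccos_nonneg α]) le_rfl
  rw [potential_equilibrium, hr.2, hb.2, hc.2,
    ← ENNReal.ofReal_mul hα, ← ENNReal.ofReal_add hb.1 hc.1,
    ← ENNReal.ofReal_add (mul_nonneg hα hr.1) (add_nonneg hb.1 hc.1)]
  congr 1
  simp only [bandTerm, capValue, Real.cos_zero, Real.cos_pi, Real.cos_pi_sub,
    Real.cos_arccos (by linarith : -1 ≤ α) hα1]
  norm_num
  ring

/-- One summand of Gibbs' inequality, from log x ≤ x - 1 at x = v/u. -/
theorem sub_le_mul_log_sub_log {u v : ℝ} (hu : 0 ≤ u) (hv : 0 < v) :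
    u - v ≤ u * (Real.log u - Real.log v) := by
  rcases hu.eq_or_lt with rfl | hu
  · simpa using hv.le
  · have h := Real.log_le_sub_one_of_pos (div_pos hv hu)
    rw [Real.log_div hv.ne' hu.ne'] at h
    have := mul_le_mul_of_nonneg_left h hu.le
    rw [mul_sub, mul_sub, mul_div_cancel₀ _ hu.ne'] at this
    linarith

theorem potential_equilibrium_equator {α : ℝ} (hα : 0 ≤ α) (hα1 : α ≤ 1) (φ : ℝ) :
    ∫⁻ y, coulomb (spherePoint (Real.pi / 2, φ)) y ∂equilibrium α
      = ENNReal.ofReal (ringValue α) := by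
  rw [potential_equilibrium_gap φ hα hα1 (Real.arccos_le_pi_div_two.2 hα) le_rfl]
  congr 1
  have h2 : Real.log (1 / 2) = -Real.log 2 := by rw [one_div, Real.log_inv]
  simp only [Real.cos_pi_div_two, capValue, ringValue, add_zero, sub_zero, h2]
  ring

theorem capValue_le_potential_equilibrium {α : ℝ} (hα : 0 < α) (hα1 : α ≤ 1) {x : Space}
    (hx : x ∈ sphere) :
    ENNReal.ofReal (capValue α) ≤ ∫⁻ y, coulomb x y ∂equilibrium α := by
  have north : ∀ θ φ, 0 ≤ θ → θ ≤ Real.pi / 2 → ENNReal.ofReal (capValue α)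
      ≤ ∫⁻ y, coulomb (spherePoint (θ, φ)) y ∂equilibrium α := by
    intro θ φ h0 h
    rcases le_total θ (Real.arccos α) with hc | hc
    · exact (potential_equilibrium_cap φ hα.le hα1 h0 hc).ge
    · rw [potential_equilibrium_gap φ hα.le hα1 hc h]
      refine ENNReal.ofReal_le_ofReal ?_
      have hcos : 0 ≤ Real.cos θ := Real.cos_nonneg_of_mem_Icc ⟨by linarith, h⟩
      have h1 := sub_le_mul_log_sub_log (by linarith : 0 ≤ (1 + α) / 2)
        (by linarith : 0 < (1 + Real.cos θ) / 2)
      -- At the pole the weight (1 - cos θ)/2 vanishes. The pole belongs to the gap only if α = 1,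
      -- and then both sides are 0. The left sides of `h1` and `h2` sum to 0.
      have h2 : (1 - α) / 2 - (1 - Real.cos θ) / 2
          ≤ (1 - α) / 2 * (Real.log ((1 - α) / 2) - Real.log ((1 - Real.cos θ) / 2)) := by
        rcases (Real.cos_le_one θ).eq_or_lt with he | hlt
        · have : α = 1 := by
            have := Real.cos_le_cos_of_nonneg_of_le_pi (Real.arccos_nonneg α)
              (by linarith [Real.pi_pos]) hc
            rw [he, Real.cos_arccos (by linarith) hα1] at this
            linarith
          simp [this, he]
        · exact sub_le_mul_log_sub_log (by linarith) (by linarith)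
      linarith
  obtain ⟨θ, φ, h0, hpi, rfl, -⟩ := exists_spherePoint hx
  rcases le_total θ (Real.pi / 2) with h | h
  · exact north θ φ h0 h
  · rw [← potential_mirror (isAdmissible_equilibrium hα.le hα1).symmetric, mirror_spherePoint]
    exact north _ φ (by linarith) (by linarith)

/-! ### Minimality of the equilibrium -/

theorem mutualEnergy_equilibrium {α : ℝ} (hα : 0 ≤ α) (hα1 : α ≤ 1) :
    mutualEnergy (equilibrium α) (equilibrium α)
      = ENNReal.ofReal (ringValue α) * ENNReal.ofReal α
        + ENNReal.ofReal (capValue α) * ENNReal.ofReal (1 - α) := by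
  have := (isAdmissible_equilibrium hα hα1).isProbabilityMeasure hα hα1
  have hn := Real.arccos_nonneg α
  have hl := Real.arccos_le_pi α
  have hm : Measurable fun x => ∫⁻ y, coulomb x y ∂equilibrium α :=
    measurable_coulomb.lintegral_prod_right'
  have hcap : ∀ θ, 0 ≤ θ → θ ≤ Real.arccos α →
      ∫⁻ φ, ∫⁻ y, coulomb (spherePoint (θ, φ)) y ∂equilibrium α ∂azimuth
        = ENNReal.ofReal (capValue α) := by
    intro θ h0 h
    simp_rw [potential_equilibrium_cap _ hα hα1 h0 h]
    simp
  have hcap' : ∀ θ, Real.pi - Real.arccos α ≤ θ → θ ≤ Real.pi →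
      ∫⁻ φ, ∫⁻ y, coulomb (spherePoint (θ, φ)) y ∂equilibrium α ∂azimuth
        = ENNReal.ofReal (capValue α) := by
    intro θ h0 h
    rw [← hcap (Real.pi - θ) (by linarith) (by linarith)]
    refine lintegral_congr fun φ => ?_
    rw [← mirror_spherePoint, potential_mirror (isAdmissible_equilibrium hα hα1).symmetric]
  rw [mutualEnergy]
  rw [show ∀ f : Space → ENNReal, ∫⁻ x, f x ∂equilibrium α = ∫⁻ x, f x ∂ringMeasure (polarLaw α)
    from fun _ => rfl, lintegral_ringMeasure _ hm, lintegral_polarLaw,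
    lintegral_band_const fun θ hθ => hcap θ hθ.1 hθ.2,
    lintegral_band_const fun θ hθ => hcap' θ hθ.1 hθ.2, ← mul_add, band_univ le_rfl hn hl,
    band_univ (by linarith) (by linarith) le_rfl, Real.cos_pi_sub,
    Real.cos_arccos (by linarith) hα1, ← ENNReal.ofReal_add]
  · simp_rw [potential_equilibrium_equator hα hα1]
    rw [lintegral_const, measure_univ, mul_one, mul_comm]
    congr 3
    simp; ring
  · rw [Real.cos_zero]; linarith
  · rw [Real.cos_pi]; linarith

/-- The equilibrium potential is at least `ringValue α` on the equator and at least `capValue α`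
elsewhere. Integrated against the prescribed charges of ν, these bounds give the value attained by
the equilibrium itself. -/
theorem le_mutualEnergy_equilibrium_right {α : ℝ} (hα : 0 < α) (hα1 : α ≤ 1) {ν : Measure Space}
    (hν : IsAdmissible α ν) :
    mutualEnergy (equilibrium α) (equilibrium α) ≤ mutualEnergy ν (equilibrium α) := by
  have heq : ∀ x ∈ equator, ENNReal.ofReal (ringValue α) ≤ ∫⁻ y, coulomb x y ∂equilibrium α := by
    intro x hx
    obtain ⟨θ, φ, h0, hpi, rfl, hcos⟩ := exists_spherePoint hx.1
    rw [hx.2, mul_zero, ← Real.cos_pi_div_two] at hcos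
    have hθ : θ = Real.pi / 2 := Real.injOn_cos ⟨h0, hpi⟩
      ⟨by linarith [Real.pi_pos], by linarith [Real.pi_pos]⟩ hcos
    rw [hθ, potential_equilibrium_equator hα.le hα1]
  rw [mutualEnergy_equilibrium hα.le hα1, ← hν.on_equator, ← hν.on_body, mutualEnergy]
  refine le_trans ?_ (setLIntegral_le_lintegral sphere _)
  rw [← lintegral_inter_add_sdiff _ sphere measurableSet_equator,
    Set.inter_eq_self_of_subset_right (show equator ⊆ sphere from fun x hx => hx.1),
    ← setLIntegral_const, ← setLIntegral_const]
  exact add_le_add (setLIntegral_mono' measurableSet_equator heq)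
    (setLIntegral_mono' (measurableSet_sphere.diff measurableSet_equator) fun x hx =>
      capValue_le_potential_equilibrium hα hα1 hx.1)

/-- The equilibrium distribution minimises the self-energy. -/
theorem mutualEnergy_equilibrium_le {α : ℝ} (hα : 0 < α) (hα1 : α ≤ 1) {ν : Measure Space}
    (hν : IsAdmissible α ν) :
    mutualEnergy (equilibrium α) (equilibrium α) ≤ mutualEnergy ν ν := by
  have he := isAdmissible_equilibrium hα.le hα1
  have := he.isProbabilityMeasure hα.le hα1
  have := hν.isProbabilityMeasure hα.le hα1
  have hfin : mutualEnergy (equilibrium α) (equilibrium α) ≠ ⊤ := by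
    rw [mutualEnergy_equilibrium hα.le hα1]
    finiteness
  rw [← ENNReal.add_le_add_iff_right hfin, ← two_mul]
  calc _ ≤ 2 * mutualEnergy ν (equilibrium α) := by
        gcongr; exact le_mutualEnergy_equilibrium_right hα hα1 hν
    _ ≤ _ := two_mul_mutualEnergy_le _ _ hν.ae_mem_sphere he.ae_mem_sphere

theorem mutualEnergy_uniformCharge {ν : Measure Space} [IsProbabilityMeasure ν]
    (hν : ∀ᵐ x ∂ν, x ∈ sphere) : mutualEnergy ν uniformCharge = ENNReal.ofReal (1 / 2) := by
  have : ∀ᵐ x ∂ν, ∫⁻ y, coulomb x y ∂uniformCharge = ENNReal.ofReal (1 / 2) := by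
    filter_upwards [hν] with x hx using potential_uniformCharge hx
  rw [mutualEnergy, lintegral_congr_ae this]
  simp

theorem mutualEnergy_uniformCharge_self :
    mutualEnergy uniformCharge uniformCharge = ENNReal.ofReal (1 / 2) := by
  have hs : ∀ᵐ x ∂uniformCharge, x ∈ sphere := by
    rw [uniformCharge_eq, ae_iff, ← Set.compl_def]
    rw [ringMeasure_apply _ measurableSet_sphere.compl (t := ∅), measure_empty]
    simp [spherePoint_mem_sphere]
  have : IsProbabilityMeasure uniformCharge := by
    refine ⟨?_⟩
    rw [uniformCharge_eq, ringMeasure_apply _ MeasurableSet.univ (t := Set.univ) (by simp),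
      band_univ le_rfl Real.pi_pos.le le_rfl]
    simp
  exact mutualEnergy_uniformCharge hs

theorem energy_eq {ν : Measure Space} [IsProbabilityMeasure ν] (hν : ∀ᵐ x ∂ν, x ∈ sphere) :
    energy ν = ((1 / 2 : ℝ) : EReal) * (mutualEnergy ν ν : EReal) - ((1 / 2 : ℝ) : EReal)
      + ((1 / 4 : ℝ) : EReal) := by
  rw [energy, mutualEnergy_uniformCharge hν, mutualEnergy_uniformCharge_self,
    EReal.coe_ennreal_ofReal, max_eq_left (by norm_num), ← EReal.coe_mul]
  norm_num

/-! ### The minimum energy in closed form -/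

theorem ringValue_eq {α : ℝ} (hα : 0 ≤ α) :
    ringValue α = (1 - α) / 2 + (1 + α) / 2 * Real.log (1 + α) := by
  rw [ringValue, Real.log_div (by linarith) two_ne_zero]; ring

theorem capValue_eq {α : ℝ} (hα : 0 ≤ α) (hα1 : α ≤ 1) :
    capValue α = 1 / 2
      + ((1 + α) * Real.log (1 + α) - (1 - α) * Real.log (1 - α)) / 4 - α / 2 := by
  -- At α = 1 the quotient rule for log fails at 0, but the factor 1 - α removes that term.
  rcases hα1.eq_or_lt with rfl | hlt
  · rw [capValue, Real.log_div (by linarith) two_ne_zero]; norm_num; ring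
  · rw [capValue, Real.log_div (by linarith) two_ne_zero, Real.log_div (by linarith) two_ne_zero]
    ring

theorem capValue_nonneg {α : ℝ} (hα : 0 ≤ α) (hα1 : α ≤ 1) : 0 ≤ capValue α := by
  have h1 := sub_le_mul_log_sub_log (by linarith : 0 ≤ 1 + α) one_pos
  have h2 := mul_nonpos_of_nonneg_of_nonpos (by linarith : 0 ≤ 1 - α)
    (Real.log_nonpos (by linarith : 0 ≤ 1 - α) (by linarith))
  rw [capValue_eq hα hα1]
  rw [Real.log_one, sub_zero] at h1
  linarith

theorem ringValue_nonneg {α : ℝ} (hα : 0 ≤ α) (hα1 : α ≤ 1) : 0 ≤ ringValue α := by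
  rw [ringValue_eq hα]
  have := Real.log_nonneg (by linarith : 1 ≤ 1 + α)
  have : 0 ≤ 1 - α := by linarith
  positivity

theorem energy_equilibrium {α : ℝ} (hα : 0 ≤ α) (hα1 : α ≤ 1) :
    energy (equilibrium α) = ((rate α / 8 : ℝ) : EReal) := by
  have he := isAdmissible_equilibrium hα hα1
  have := he.isProbabilityMeasure hα hα1
  have h1 := ringValue_nonneg hα hα1
  have h2 := capValue_nonneg hα hα1
  have h3 : 0 ≤ 1 - α := by linarith
  rw [energy_eq he.ae_mem_sphere, mutualEnergy_equilibrium hα hα1, ← ENNReal.ofReal_mul h1,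
    ← ENNReal.ofReal_mul h2, ← ENNReal.ofReal_add (by positivity) (by positivity),
    EReal.coe_ennreal_ofReal, max_eq_left (by positivity), ← EReal.coe_mul, ← EReal.coe_sub,
    ← EReal.coe_add, rate, ringValue_eq hα, capValue_eq hα hα1]
  congr 1
  ring

theorem minEnergy_eq {α : ℝ} (hα : 0 < α) (hα1 : α ≤ 1) :
    minEnergy α = ((rate α / 8 : ℝ) : EReal) := by
  have he := isAdmissible_equilibrium hα.le hα1
  have := he.isProbabilityMeasure hα.le hα1
  rw [← energy_equilibrium hα.le hα1]
  refine le_antisymm (iInf₂_le _ he) (le_iInf₂ fun ν hν => ?_)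
  have := hν.isProbabilityMeasure hα.le hα1
  rw [energy_eq he.ae_mem_sphere, energy_eq hν.ae_mem_sphere]
  have hle := mutualEnergy_equilibrium_le hα hα1 hν
  refine add_le_add (EReal.sub_le_sub (mul_le_mul_of_nonneg_left ?_ ?_) le_rfl) le_rfl
  · exact EReal.coe_ennreal_le_coe_ennreal_iff.2 hle
  · exact EReal.coe_nonneg.2 (by norm_num)

/-- Only x log x occurs, which is continuous at 0 with `Real.log 0 = 0`; hence `rate 1` is the limit
from below. -/
theorem rate_eq (α : ℝ) : rate α = -2 * α + (1 + α) * ((1 + α) * Real.log (1 + α))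
    - (1 - α) * ((1 - α) * Real.log (1 - α)) := by
  rw [rate]; ring

theorem continuous_rate : Continuous rate := by
  have h := Real.continuous_mul_log
  have h1 : Continuous fun α : ℝ => (1 + α) * Real.log (1 + α) := h.comp (by fun_prop)
  have h2 : Continuous fun α : ℝ => (1 - α) * Real.log (1 - α) := h.comp (by fun_prop)
  rw [show rate = _ from funext rate_eq]
  fun_prop

/-- The rate vanishes at 0 and increases strictly on [0, 1]. Positivity lets the limit of the
hypothesis be turned into a limit of ratios. -/
theorem rate_pos {α : ℝ} (hα : 0 < α) (hα1 : α ≤ 1) : 0 < rate α := by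
  have hmono : StrictMonoOn rate (Set.Icc 0 1) := by
    refine strictMonoOn_of_deriv_pos (convex_Icc 0 1) continuous_rate.continuousOn fun x hx => ?_
    rw [interior_Icc] at hx
    have hp : 0 < 1 + x := by linarith [hx.1]
    have hm : 0 < 1 - x := by linarith [hx.2]
    have e1 : HasDerivAt (fun y : ℝ => 1 + y) 1 x := (hasDerivAt_id x).const_add 1
    have e2 : HasDerivAt (fun y : ℝ => 1 - y) (-1) x := (hasDerivAt_id x).const_sub 1
    have d1 := e1.mul ((Real.hasDerivAt_mul_log hp.ne').comp x e1)
    have d2 := e2.mul ((Real.hasDerivAt_mul_log hm.ne').comp x e2)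
    have d := (((hasDerivAt_id x).const_mul (-2)).add d1).sub d2
    have d' : HasDerivAt rate
        (2 * ((1 + x) * Real.log (1 + x)) + 2 * ((1 - x) * Real.log (1 - x))) x := by
      rw [show rate = _ from funext rate_eq]
      refine d.congr_deriv ?_
      simp only [Function.comp]
      ring
    rw [d'.deriv]
    -- The derivative is positive because (1 + x) log(1 + x) > x and (1 - x) log(1 - x) ≥ -x.
    have l2 := Real.log_lt_sub_one_of_pos (inv_pos.2 hp)
      (inv_lt_one_of_one_lt₀ (by linarith [hx.1])).ne
    rw [Real.log_inv] at l2
    have h1 := mul_lt_mul_of_pos_left l2 hp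
    rw [mul_sub, mul_inv_cancel₀ hp.ne'] at h1
    have h2 := sub_le_mul_log_sub_log hm.le one_pos
    rw [Real.log_one, sub_zero] at h2
    linarith
  have := hmono ⟨le_rfl, zero_le_one⟩ ⟨hα.le, hα1⟩ hα
  simpa [rate] using this

end RealSpherical

/-! ### The asymptotic formula -/

theorem proposition1 :
    (∀ α : ℝ, 0 < α → α ≤ 1 → RealSpherical.ElectrostaticsHypothesis α →
      IsEquivalent (RealSpherical.fixedRatio α)
        (fun p : ℕ × ℕ => Real.log (RealSpherical.probReal p.1 p.2))
        (fun p : ℕ × ℕ => -((p.1 : ℝ) ^ 2 / 8) * RealSpherical.rate α)) ∧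
    Tendsto RealSpherical.rate (𝓝[<] 1) (𝓝 (RealSpherical.rate 1)) ∧
    -(1 / 8) * RealSpherical.rate 1 = 1 / 4 - Real.log 2 / 2 := by
  refine ⟨fun α hα hα1 h => ?_, RealSpherical.continuous_rate.continuousWithinAt.tendsto, ?_⟩
  · have hr := RealSpherical.rate_pos hα hα1
    rw [RealSpherical.ElectrostaticsHypothesis, RealSpherical.minEnergy_eq hα hα1,
      EReal.tendsto_coe] at h
    have hN : ∀ᶠ p : ℕ × ℕ in RealSpherical.fixedRatio α, (p.1 : ℝ) ≠ 0 := by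
      have ht : Tendsto Prod.fst (RealSpherical.fixedRatio α) (atTop : Filter ℕ) :=
        tendsto_comap.mono_left inf_le_left
      filter_upwards [ht.eventually_gt_atTop 0] with p hp
      exact_mod_cast hp.ne'
    rw [isEquivalent_iff_tendsto_one]
    · have h' := h.div_const (RealSpherical.rate α / 8)
      rw [div_self (by positivity)] at h'
      refine h'.congr' ?_
      filter_upwards [hN] with p hp
      simp only [Pi.div_apply]
      field_simp
    · filter_upwards [hN] with p hp
      have : (p.1 : ℝ) ^ 2 ≠ 0 := pow_ne_zero 2 hp
      simp [hp, hr.ne']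
  · rw [RealSpherical.rate]
    norm_num
    ring
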